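/- Let $n\ge 2$, let $\Delta=\{p\in\mathbb R^n: p_i>0,\ \sum_i p_i=1\}$ be the open unit simplex with closure $\overline\Delta$, and let $m$ be the surface measure ($(n-1)$-dimensional Lebesgue measure) on $\Delta$. A portfolio is a Borel map $\pi:\Delta\to\overline\Delta$; write $\pi(p)/p=(\pi_1(p)/p_1,\dots,\pi_n(p)/p_n)$. Let $\mathcal{FG}$ be the set of pairs $(\pi,\Phi)$ where $\pi$ is a portfolio and $\Phi:\Delta\to(0,\infty)$ is a concave function generating it, i.e. $$1+\Big\langle \frac{\pi(p)}{p},\,q-p\Big\rangle\ \ge\ \frac{\Phi(q)}{\Phi(p)}\qquad\text{for all }p,q\in\Delta,$$ and for $(\pi,\Phi)\in\mathcal{FG}$ let $$T_{\pi,\Phi}(q\mid p)=\log\Big(1+\Big\langle \frac{\pi(p)}{p},\,q-p\Big\rangle\Big)-\log\frac{\Phi(q)}{\Phi(p)},\qquad p,q\in\Delta.$$ Let $\mathbb P$ be a Borel probability measure on $\Delta\times\Delta$ that is either discrete (carried by a countable set) or absolutely continuous with respect to $m\otimes m$, and suppose that $\mathbb P$ is supported on $K\times K$, i.e. $\mathbb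 P(K\times K)=1$, for some compact $K\subset\Delta$. Then $\int T_{\pi,\Phi}(q\mid p)\,d\mathbb P(p,q)$ is a finite integral for every $(\pi,\Phi)\in\mathcal{FG}$, and: (i) The optimization problem $$\max_{(\pi,\Phi)\in\mathcal{FG}}\ \int T_{\pi,\Phi}(q\mid p)\,d\mathbb P(p,q)$$ has an optimal solution (the maximum is attained). (ii) If $(\pi^{(1)},\Phi^{(1)})$ and $(\pi^{(2)},\Phi^{(2)})$ are optimal solutions, then $$\Big\langle \frac{\pi^{(1)}(p)}{p},\,q-p\Big\rangle=\Big\langle \frac{\pi^{(2)}(p)}{p},\,q-p\Big\rangle\qquad\text{for }\mathbb P\text{-almost all }(p,q).$$ In particular, suppose that $\mathbb P$ is absolutely continuous, $\mathbb P(dp\,dq)=\mathbb P_1(dp)\,\mathbb P_2(dq\mid p)$ with $\mathbb P_1(dp)=f(p)\,m(dp)$, and that $\mathbb P$ satisfies the support condition: for $m$-almost all $p$ with $f(p)>0$ and for all $v\in\mathbb R^n$ with $\sum_i v_i=0$ there exists $\lambda>0$ such that $p+\lambda v$ belongs to the support of $\mathbb P_2(\cdot\mid p)$. Then $\pi^{(1)}=\pi^{(2)}$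 $m$-almost everywhere on $\{p: f(p)>0\}$. -/

import Mathlib

open MeasureTheory ProbabilityTheory
open scoped ENNReal

/-- The open unit simplex `Δ⁽ⁿ⁾` in `ℝⁿ` (with the Euclidean metric). -/
def openSimplex (n : ℕ) : Set (EuclideanSpace ℝ (Fin n)) :=
  {p | (∀ i, 0 < p i) ∧ ∑ i, p i = 1}

/-- The closed unit simplex; it is the closure of the open one, see
`closedSimplex_eq_closure`. -/
def closedSimplex (n : ℕ) : Set (EuclideanSpace ℝ (Fin n)) :=
  {p | (∀ i, 0 ≤ p i) ∧ ∑ i, p i = 1}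

theorem closedSimplex_eq_closure (n : ℕ) : closedSimplex n = closure (openSimplex n) := by
  apply Set.Subset.antisymm
  · intro x hx
    have hn : (0 : ℝ) < n := by
      rcases Nat.eq_zero_or_pos n with h | h
      · subst h
        have h2 := hx.2
        simp at h2
      · exact_mod_cast h
    let c : EuclideanSpace ℝ (Fin n) := WithLp.toLp 2 (fun _ => (1 / (n : ℝ)))
    have hcont : Continuous (fun t : ℝ => (1 - t) • x + t • c) := by fun_prop
    have hlim : Filter.Tendsto (fun t : ℝ => (1 - t) • x + t • c)
        (nhdsWithin 0 (Set.Ioi 0)) (nhds x) := by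
      have := hcont.tendsto 0
      simp only [sub_zero, one_smul, zero_smul, add_zero] at this
      exact this.mono_left nhdsWithin_le_nhds
    refine mem_closure_of_tendsto hlim ?_
    have hmem : Set.Ioo (0 : ℝ) 1 ∈ nhdsWithin (0 : ℝ) (Set.Ioi 0) :=
      Ioo_mem_nhdsGT one_pos
    filter_upwards [hmem] with t ht
    refine ⟨fun i => ?_, ?_⟩
    · have h1 := mul_nonneg (sub_nonneg.2 ht.2.le) (hx.1 i)
      have h2 : 0 < t * (1 / (n : ℝ)) := by have := ht.1; positivity
      simp only [PiLp.add_apply, PiLp.smul_apply, smul_eq_mul, c]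
      linarith
    · simp only [PiLp.add_apply, PiLp.smul_apply, smul_eq_mul, c, Finset.sum_add_distrib,
        ← Finset.mul_sum, hx.2]
      simp
      field_simp
      ring
  · refine closure_minimal (fun p hp => ⟨fun i => (hp.1 i).le, hp.2⟩) ?_
    have : closedSimplex n = (⋂ i, {p | 0 ≤ p i}) ∩ {p | ∑ i, p i = 1} := by
      ext p
      simp [closedSimplex]
    rw [this]
    refine (isClosed_iInter fun i => ?_).inter ?_
    · exact isClosed_le continuous_const (by fun_prop)
    · exact isClosed_eq (by fun_prop) continuous_const

/-- The pairing `⟨π(p)/p, q - p⟩ = ∑ᵢ (πᵢ(p) / pᵢ) (qᵢ - pᵢ)` of the weight ratio of the portfolio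
`π` at `p` with the displacement `q - p`. -/
noncomputable def weightRatioPairing {n : ℕ} (π : openSimplex n → closedSimplex n)
    (p q : openSimplex n) : ℝ :=
  ∑ i, (π p).1 i / p.1 i * (q.1 i - p.1 i)

/-- `(π, Φ) ∈ FG`: the portfolio `π`, a Borel map from the open to the closed simplex, is generated
by the positive concave function `Φ` on the open simplex. Only the values of `Φ` on the open simplex
matter. -/
structure IsFunctionallyGenerated {n : ℕ} (π : openSimplex n → closedSimplex n)
    (Φ : EuclideanSpace ℝ (Fin n) → ℝ) : Prop where
  measurable : Measurable π
  concave : ConcaveOn ℝ (openSimplex n) Φ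
  pos : ∀ p ∈ openSimplex n, 0 < Φ p
  superdiff : ∀ p q : openSimplex n, Φ q / Φ p ≤ 1 + weightRatioPairing π p q

/-- The L-divergence `T(q ∣ p)` of the pair `(π, Φ)`. -/
noncomputable def LDivergence {n : ℕ} (π : openSimplex n → closedSimplex n)
    (Φ : EuclideanSpace ℝ (Fin n) → ℝ) (q p : openSimplex n) : ℝ :=
  Real.log (1 + weightRatioPairing π p q) - Real.log (Φ q / Φ p)

/-- The surface measure `m` of the open simplex: `(n - 1)`-dimensional Hausdorff measure for the
Euclidean metric, normalized to agree with Lebesgue measure in dimension `n - 1`. -/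
noncomputable def simplexMeasure (n : ℕ) : Measure (openSimplex n) :=
  Measure.euclideanHausdorffMeasure (n - 1)

/-- `P` is a discrete measure: it is carried by a countable set. -/
def IsDiscreteMeasure {α : Type*} [MeasurableSpace α] (P : Measure α) : Prop :=
  ∃ S : Set α, S.Countable ∧ P Sᶜ = 0

/-- `(π, Φ)` is an optimal solution: it maximizes `∫ T(q ∣ p) dP(p, q)` over all functionally
generated portfolios. -/
def IsOptimalPortfolio {n : ℕ} (P : Measure (openSimplex n × openSimplex n))
    (π : openSimplex n → closedSimplex n) (Φ : EuclideanSpace ℝ (Fin n) → ℝ) : Prop :=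
  IsFunctionallyGenerated π Φ ∧
    ∀ (π' : openSimplex n → closedSimplex n) (Φ' : EuclideanSpace ℝ (Fin n) → ℝ),
      IsFunctionallyGenerated π' Φ' →
        ∫ x, LDivergence π' Φ' x.2 x.1 ∂P ≤ ∫ x, LDivergence π Φ x.2 x.1 ∂P

/-- The support condition, for the first marginal `f(p) m(dp)` and the conditional distribution
`P₂(dq ∣ p) = κ p`: for `m`-almost all `p` with `f p > 0`, every tangent vector `v` (`∑ᵢ vᵢ = 0`)
has a multiple `λ v`, `λ > 0`, with `p + λ v` in the support of `κ p`. -/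
def SupportCondition {n : ℕ} (f : openSimplex n → ℝ≥0∞)
    (κ : Kernel (openSimplex n) (openSimplex n)) : Prop :=
  ∀ᵐ p ∂(simplexMeasure n), 0 < f p →
    ∀ v : EuclideanSpace ℝ (Fin n), ∑ i, v i = 0 →
      ∃ c : ℝ, 0 < c ∧ ∃ q ∈ (κ p).support,
        (q : EuclideanSpace ℝ (Fin n)) = (p : EuclideanSpace ℝ (Fin n)) + c • v

/-!
Write `r = log (1 + ⟨π(p)/p, q - p⟩)` for the log return of a portfolio. Since
`1 + ⟨π(p)/p, q - p⟩` is a convex combination of the ratios `qᵢ / pᵢ`, `|r|` is at most the Thompson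
distance `maxᵢ |log qᵢ - log pᵢ|`, and so is `|log Φ(q) - log Φ(p)|` for every generating function
`Φ`. Hence integrability of this distance, automatic when `P` lives on a compact set, makes the
objective finite and bounded on `FG`.

The midpoint of two portfolios is generated by `√(Φ₁ Φ₂)`, and its L-divergence exceeds the average
of the two L-divergences by exactly `log cosh ((r₁ - r₂) / 2)`. For two maximizers this gap must
vanish almost everywhere. Along a fast maximizing sequence the gaps of consecutive terms are so
small that the log returns form a Cauchy sequence almost everywhere. By Arzelà–Ascoli a subsequence
of the normalized `log Φₖ` converges; portfolios have no such compactness, but a measurable choice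
of a limit point of `πₖ(p)` at every `p` pairs with the limit of `Φₖ`, and it has the almost
everywhere limit of the log returns. Dominated convergence then gives optimality.
-/

open Filter Topology

section PointwiseLimits

theorem exists_subseq_tendsto_of_equicontinuous {X α : Type*} [TopologicalSpace X]
    [TopologicalSpace.SeparableSpace X] [PseudoMetricSpace α] {F : ℕ → X → α}
    (hF : Equicontinuous F) (hQ : ∀ x, ∃ Q, IsCompact Q ∧ ∀ k, F k x ∈ Q) :
    ∃ φ : ℕ → ℕ, StrictMono φ ∧ ∃ f : X → α, ∀ x, Tendsto (fun k => F (φ k) x) atTop (𝓝 (f x)) := by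
  choose Q hQc hFQ using hQ
  obtain ⟨D, hDc, hD⟩ := TopologicalSpace.exists_countable_dense X
  have : Countable D := hDc.to_subtype
  obtain ⟨g, -, φ, hφ, hg⟩ := (isCompact_univ_pi fun d : D => hQc d).tendsto_subseq
    (x := fun k (d : D) => F k d) fun k d _ => hFQ d k
  suffices ∀ x, CauchySeq fun k => F (φ k) x by
    choose f _ hf using fun x =>
      cauchySeq_tendsto_of_isComplete (hQc x).isComplete (fun k => hFQ x (φ k)) (this x)
    exact ⟨φ, hφ, f, hf⟩
  refine fun x => Metric.cauchySeq_iff'.2 fun ε hε => ?_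
  obtain ⟨d, hdD, hd⟩ := hD.inter_nhds_nonempty
    (Metric.equicontinuousAt_iff_right.1 (hF x) (ε / 3) (by positivity))
  obtain ⟨M, hM⟩ := Metric.cauchySeq_iff'.1 (tendsto_pi_nhds.1 hg ⟨d, hdD⟩).cauchySeq (ε / 3)
    (by positivity)
  refine ⟨M, fun k hk => ?_⟩
  calc dist (F (φ k) x) (F (φ M) x)
      ≤ dist (F (φ k) x) (F (φ k) d) + dist (F (φ k) d) (F (φ M) d)
        + dist (F (φ M) d) (F (φ M) x) := dist_triangle4 ..
    _ < ε / 3 + ε / 3 + ε / 3 := by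
      rw [dist_comm (F (φ M) d)]
      exact add_lt_add (add_lt_add (hd _) (hM k hk)) (hd _)
    _ = ε := by ring

variable {α : Type*} [MeasurableSpace α]

theorem measurable_apply_of_countable {ι β : Type*} [MeasurableSpace β] [MeasurableSpace ι]
    [Countable ι] [MeasurableSingletonClass ι] {f : ι → α → β} (hf : ∀ i, Measurable (f i))
    {N : α → ι} (hN : Measurable N) : Measurable fun a => f (N a) a :=
  (measurable_from_prod_countable_right (f := fun x : ι × α => f x.1 x.2) hf).comp
    (hN.prodMk measurable_id)

theorem exists_measurable_index_tendsto {f : ℕ → α → ℝ} (hf : ∀ k, Measurable (f k))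
    (hb : ∀ a, ∃ C, ∀ k, |f k a| ≤ C) :
    ∃ N : ℕ → α → ℕ, (∀ j, Measurable (N j)) ∧ (∀ a, Tendsto (fun j => N j a) atTop atTop) ∧
      ∀ a, ∃ l, Tendsto (fun j => f (N j a) a) atTop (𝓝 l) := by
  classical
  -- The lower limit is a measurable choice of a limit point.
  let g : α → ℝ := fun a => liminf (fun k => f k a) atTop
  have hex (j : ℕ) (a : α) : ∃ k, j ≤ k ∧ |f k a - g a| < 1 / ((j : ℝ) + 1) := by
    have hj : (0 : ℝ) < 1 / ((j : ℝ) + 1) := by positivity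
    obtain ⟨C, hC⟩ := hb a
    have hbelow : IsBoundedUnder (· ≥ ·) atTop fun k => f k a :=
      isBoundedUnder_of ⟨-C, fun k => (abs_le.1 (hC k)).1⟩
    have habove : IsBoundedUnder (· ≤ ·) atTop fun k => f k a :=
      isBoundedUnder_of ⟨C, fun k => (abs_le.1 (hC k)).2⟩
    have hlower : ∀ᶠ k in atTop, g a - 1 / ((j : ℝ) + 1) < f k a :=
      eventually_lt_of_lt_liminf (by linarith) hbelow
    have hupper : ∃ᶠ k in atTop, f k a < g a + 1 / ((j : ℝ) + 1) :=
      frequently_lt_of_liminf_lt habove.isCoboundedUnder_ge (by linarith)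
    obtain ⟨k, hk, hk', hjk⟩ :=
      (hupper.and_eventually (hlower.and (eventually_ge_atTop j))).exists
    exact ⟨k, hjk, abs_lt.2 ⟨by linarith, by linarith⟩⟩
  refine ⟨fun j a => Nat.find (hex j a), fun j => measurable_find (hex j) fun k => ?_,
    fun a => tendsto_atTop_mono (fun j => (Nat.find_spec (hex j a)).1) tendsto_id,
    fun a => ⟨g a, tendsto_iff_dist_tendsto_zero.2 ?_⟩⟩
  · exact (MeasurableSet.const _).inter
      (measurableSet_lt ((hf k).sub (Measurable.liminf hf)).abs measurable_const)
  · exact squeeze_zero (fun _ => dist_nonneg) (fun j => (Nat.find_spec (hex j a)).2.le)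
      tendsto_one_div_add_atTop_nhds_zero_nat

theorem exists_measurable_index_tendsto_finset {ι : Type*} {f : ℕ → α → ι → ℝ}
    (hf : ∀ k, Measurable (f k)) (hb : ∀ a i, ∃ C, ∀ k, |f k a i| ≤ C) (s : Finset ι) :
    ∃ N : ℕ → α → ℕ, (∀ j, Measurable (N j)) ∧ (∀ a, Tendsto (fun j => N j a) atTop atTop) ∧
      ∀ a, ∀ i ∈ s, ∃ l, Tendsto (fun j => f (N j a) a i) atTop (𝓝 l) := by
  classical
  induction s using Finset.induction_on with
  | empty => exact ⟨fun j _ => j, fun j => measurable_const, fun _ => tendsto_id, by simp⟩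
  | insert i s _ ih =>
    obtain ⟨N, hNm, hN, hNs⟩ := ih
    obtain ⟨M, hMm, hM, hMi⟩ := exists_measurable_index_tendsto
      (fun j => (measurable_pi_apply i).comp (measurable_apply_of_countable hf (hNm j)))
      fun a => (hb a i).imp fun C hC j => hC (N j a)
    refine ⟨fun j a => N (M j a) a, fun j => measurable_apply_of_countable hNm (hMm j),
      fun a => (hN a).comp (hM a), fun a => (Finset.forall_mem_insert ..).2 ⟨hMi a, ?_⟩⟩
    exact fun i' hi' => (hNs a i' hi').imp fun l hl => hl.comp (hM a)

theorem exists_measurable_index_tendsto_pi {ι : Type*} [Finite ι] {f : ℕ → α → ι → ℝ}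
    (hf : ∀ k, Measurable (f k)) (hb : ∀ a i, ∃ C, ∀ k, |f k a i| ≤ C) :
    ∃ N : ℕ → α → ℕ, (∀ j, Measurable (N j)) ∧ (∀ a, Tendsto (fun j => N j a) atTop atTop) ∧
      ∀ a, ∃ l, Tendsto (fun j => f (N j a) a) atTop (𝓝 l) := by
  have := Fintype.ofFinite ι
  obtain ⟨N, hNm, hN, hlim⟩ := exists_measurable_index_tendsto_finset hf hb Finset.univ
  choose l hl using fun a i => hlim a i (Finset.mem_univ i)
  exact ⟨N, hNm, hN, fun a => ⟨l a, tendsto_pi_nhds.2 (hl a)⟩⟩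

theorem ae_summable_norm_of_summable_integral_norm {ι E : Type*} [Countable ι]
    [NormedAddCommGroup E] {μ : Measure α} {F : ι → α → E} (hF : ∀ i, Integrable (F i) μ)
    (hsum : Summable fun i => ∫ a, ‖F i a‖ ∂μ) : ∀ᵐ a ∂μ, Summable fun i => ‖F i a‖ := by
  have hlint : ∫⁻ a, ∑' i, ‖F i a‖ₑ ∂μ ≠ ∞ := by
    rw [lintegral_tsum fun i => (hF i).1.enorm]
    simp only [← ofReal_integral_norm_eq_lintegral_enorm (hF _)]
    exact hsum.tsum_ofReal_ne_top
  filter_upwards [ae_lt_top' (AEMeasurable.tsum fun i => (hF i).1.enorm) hlint] with a ha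
  exact NNReal.summable_coe.2 (ENNReal.tsum_coe_ne_top_iff_summable.1 ha.ne)

end PointwiseLimits

section LogCosh

theorem log_add_div_two {a b : ℝ} (ha : 0 < a) (hb : 0 < b) :
    Real.log ((a + b) / 2) = (Real.log a + Real.log b) / 2
      + Real.log (Real.cosh ((Real.log a - Real.log b) / 2)) := by
  have hfactor : (a + b) / 2 = Real.exp ((Real.log a + Real.log b) / 2)
      * Real.cosh ((Real.log a - Real.log b) / 2) := by
    rw [Real.cosh_eq, mul_div_assoc', mul_add, ← Real.exp_add, ← Real.exp_add]
    ring_nf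
    rw [Real.exp_log ha, Real.exp_log hb]
  rw [hfactor, Real.log_mul (Real.exp_pos _).ne' (Real.cosh_pos _).ne', Real.log_exp]

theorem log_cosh_nonneg (s : ℝ) : 0 ≤ Real.log (Real.cosh s) :=
  Real.log_nonneg (Real.one_le_cosh s)

theorem log_cosh_eq_zero {s : ℝ} : Real.log (Real.cosh s) = 0 ↔ s = 0 := by
  refine ⟨fun h => ?_, fun h => by simp [h]⟩
  by_contra hs
  exact (Real.log_pos (Real.one_lt_cosh.2 hs)).ne' h

theorem one_add_sq_div_two_le_cosh (s : ℝ) : 1 + s ^ 2 / 2 ≤ Real.cosh s := by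
  have h := sum_le_hasSum (Finset.range 2)
    (fun k _ => by rw [pow_mul]; positivity) (Real.hasSum_cosh s)
  simpa [Finset.sum_range_succ] using h

theorem sq_le_four_mul_log_cosh {s : ℝ} (h : Real.log (Real.cosh s) ≤ 1) :
    s ^ 2 ≤ 4 * Real.log (Real.cosh s) := by
  have hexp := Real.exp_log (Real.cosh_pos s)
  have h0 := log_cosh_nonneg s
  have := Real.abs_exp_sub_one_le (x := Real.log (Real.cosh s)) (by rwa [abs_of_nonneg h0])
  rw [hexp, abs_of_nonneg h0] at this
  linarith [le_abs_self (Real.cosh s - 1), one_add_sq_div_two_le_cosh s]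

/- As `log cosh s ≥ s² / 4` for small `s`, the hypothesis makes the increments of `r` of order
`2⁻ᵏ`. -/
theorem exists_tendsto_of_tendsto_mul_log_cosh {r : ℕ → ℝ}
    (h : Tendsto (fun k => 4 ^ k * Real.log (Real.cosh ((r k - r (k + 1)) / 2))) atTop (𝓝 0)) :
    ∃ l, Tendsto r atTop (𝓝 l) := by
  refine cauchySeq_tendsto_of_complete (cauchySeq_of_summable_dist ?_)
  refine .of_norm_bounded_eventually (summable_geometric_two.mul_left 4) ?_
  rw [Nat.cofinite_eq_atTop]
  filter_upwards [h.eventually_le_const one_pos] with k hk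
  set s := (r k - r (k + 1)) / 2 with hs
  have hgap : Real.log (Real.cosh s) ≤ ((1 / 2) ^ k) ^ 2 := by
    rw [← pow_mul, mul_comm k, pow_mul, one_div_pow, one_div_pow, le_div_iff₀' (by positivity)]
    norm_num [hk]
  have hs2 : s ^ 2 ≤ (2 * (1 / 2) ^ k) ^ 2 := by
    have hle : Real.log (Real.cosh s) ≤ 1 :=
      hgap.trans (pow_le_one₀ (by positivity) (pow_le_one₀ (by norm_num) (by norm_num)))
    linarith [sq_le_four_mul_log_cosh hle, mul_pow (2 : ℝ) ((1 / 2) ^ k) 2]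
  have habs := abs_le_of_sq_le_sq hs2 (by positivity)
  rw [Real.norm_of_nonneg dist_nonneg, Real.dist_eq, show r k - r k.succ = 2 * s by rw [hs]; ring,
    abs_mul, abs_two]
  linarith [habs]

end LogCosh

namespace openSimplex

variable {n : ℕ}

theorem convex : Convex ℝ (openSimplex n) := by
  refine fun x hx y hy a b ha hb hab => ⟨fun i => ?_, ?_⟩
  · exact convex_Ioi (0 : ℝ) (hx.1 i) (hy.1 i) ha hb hab
  · simp only [PiLp.add_apply, PiLp.smul_apply, smul_eq_mul, Finset.sum_add_distrib,
      ← Finset.mul_sum, hx.2, hy.2, mul_one, hab]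

/-- The Thompson metric `maxᵢ |log pᵢ - log qᵢ|`; it controls log returns and the logarithms of
generating functions uniformly over all functionally generated portfolios. -/
noncomputable def logDist (p q : openSimplex n) : ℝ :=
  dist (fun i => Real.log (p.1 i)) (fun i => Real.log (q.1 i))

theorem logDist_comm (p q : openSimplex n) : logDist p q = logDist q p :=
  dist_comm _ _

theorem logDist_self (p : openSimplex n) : logDist p p = 0 :=
  dist_self _

theorem abs_log_div_le_logDist (p q : openSimplex n) (i : Fin n) :
    |Real.log (q.1 i / p.1 i)| ≤ logDist p q := by
  rw [Real.log_div (q.2.1 i).ne' (p.2.1 i).ne', abs_sub_comm]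
  exact dist_le_pi_dist (fun i => Real.log (p.1 i)) (fun i => Real.log (q.1 i)) i

theorem continuous_logDist :
    Continuous fun x : openSimplex n × openSimplex n => logDist x.1 x.2 := by
  have hlog : Continuous fun (p : openSimplex n) i => Real.log (p.1 i) :=
    continuous_pi fun i => Continuous.log (by fun_prop) fun p => (p.2.1 i).ne'
  exact (hlog.comp continuous_fst).dist (hlog.comp continuous_snd)

theorem integrable_logDist_of_isCompact {P : Measure (openSimplex n × openSimplex n)}
    [IsFiniteMeasureOnCompacts P] {K : Set (openSimplex n)} (hK : IsCompact K)
    (hPK : P (K ×ˢ K)ᶜ = 0) : Integrable (fun x => logDist x.1 x.2) P := by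
  rw [← Measure.restrict_eq_self_of_ae_mem (μ := P) (s := K ×ˢ K) hPK]
  exact continuous_logDist.continuousOn.integrableOn_compact (hK.prod hK)

end openSimplex

open openSimplex

theorem convex_closedSimplex (n : ℕ) : Convex ℝ (closedSimplex n) :=
  closedSimplex_eq_closure n ▸ openSimplex.convex.closure

theorem isClosed_closedSimplex (n : ℕ) : IsClosed (closedSimplex n) :=
  closedSimplex_eq_closure n ▸ isClosed_closure

section Portfolio

variable {n : ℕ} (π π₁ π₂ : openSimplex n → closedSimplex n)

theorem one_add_weightRatioPairing (p q : openSimplex n) :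
    1 + weightRatioPairing π p q = ∑ i, (π p).1 i * (q.1 i / p.1 i) := by
  rw [weightRatioPairing, ← (π p).2.2, ← Finset.sum_add_distrib]
  refine Finset.sum_congr rfl fun i _ => ?_
  have := (p.2.1 i).ne'
  field_simp
  ring

theorem one_add_weightRatioPairing_mem {p q : openSimplex n} {s : Set ℝ} (hs : Convex ℝ s)
    (h : ∀ i, q.1 i / p.1 i ∈ s) : 1 + weightRatioPairing π p q ∈ s := by
  rw [one_add_weightRatioPairing]
  exact hs.sum_mem (fun i _ => (π p).2.1 i) (π p).2.2 fun i _ => h i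

theorem one_add_weightRatioPairing_pos (p q : openSimplex n) :
    0 < 1 + weightRatioPairing π p q :=
  one_add_weightRatioPairing_mem π (convex_Ioi 0) fun i => div_pos (q.2.1 i) (p.2.1 i)

theorem smul_weightRatioPairing_add_eq_zero {p x y : openSimplex n} {a b : ℝ} (hab : a + b = 1)
    (hp : p.1 = a • x.1 + b • y.1) :
    a * weightRatioPairing π p x + b * weightRatioPairing π p y = 0 := by
  simp only [weightRatioPairing, Finset.mul_sum, ← Finset.sum_add_distrib]
  refine Finset.sum_eq_zero fun i _ => ?_
  have hpi : p.1 i = a * x.1 i + b * y.1 i := by simp [hp]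
  linear_combination (π p).1 i / p.1 i * (-hpi - p.1 i * hab)

theorem continuous_weightRatioPairing (p : openSimplex n) :
    Continuous (weightRatioPairing π p) := by
  unfold weightRatioPairing
  fun_prop

/-- The log return `log (1 + ⟨π(p)/p, q - p⟩)` of the portfolio `π` when the market moves from `p`
to `q`. -/
noncomputable def logReturn (p q : openSimplex n) : ℝ :=
  Real.log (1 + weightRatioPairing π p q)

theorem abs_logReturn_le (p q : openSimplex n) : |logReturn π p q| ≤ logDist p q := by
  rw [abs_le, logReturn, Real.le_log_iff_exp_le (one_add_weightRatioPairing_pos π p q),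
    Real.log_le_iff_le_exp (one_add_weightRatioPairing_pos π p q)]
  refine one_add_weightRatioPairing_mem π (convex_Icc _ _) fun i => ?_
  have hpos : 0 < q.1 i / p.1 i := div_pos (q.2.1 i) (p.2.1 i)
  rw [Set.mem_Icc, ← Real.le_log_iff_exp_le hpos, ← Real.log_le_iff_le_exp hpos]
  exact abs_le.1 (abs_log_div_le_logDist p q i)

theorem logReturn_eq_logReturn_iff {p q : openSimplex n} :
    logReturn π₁ p q = logReturn π₂ p q ↔ weightRatioPairing π₁ p q = weightRatioPairing π₂ p q :=
  (Real.log_injOn_pos.eq_iff (one_add_weightRatioPairing_pos π₁ p q)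
    (one_add_weightRatioPairing_pos π₂ p q)).trans (add_right_inj 1)

variable {π π₁ π₂}

theorem measurable_logReturn (hπ : Measurable π) :
    Measurable fun x : openSimplex n × openSimplex n => logReturn π x.1 x.2 := by
  simp only [logReturn, one_add_weightRatioPairing]
  refine (Finset.measurable_fun_sum _ fun i _ => ?_).log
  exact Measurable.mul (by fun_prop) (Measurable.div (by fun_prop) (by fun_prop))

theorem tendsto_logReturn {ι : Type*} {l : Filter ι} {σ : ι → openSimplex n → closedSimplex n}
    {p : openSimplex n} (h : Tendsto (fun k => σ k p) l (𝓝 (π p))) (q : openSimplex n) :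
    Tendsto (fun k => logReturn (σ k) p q) l (𝓝 (logReturn π p q)) := by
  have hpair : Continuous fun w : closedSimplex n => ∑ i, w.1 i / p.1 i * (q.1 i - p.1 i) := by
    fun_prop
  exact (((hpair.tendsto (π p)).comp h).const_add 1).log
    (one_add_weightRatioPairing_pos π p q).ne'

/-- The displacement `v = π₁(p) - π₂(p)` alone separates `π₁(p)` from `π₂(p)`, since the pairings
with it differ by `∑ᵢ vᵢ² / pᵢ`. -/
theorem portfolio_eq_of_weightRatioPairing_eq {p q : openSimplex n} {c : ℝ} (hc : c ≠ 0)
    (hq : q.1 = p.1 + c • ((π₁ p).1 - (π₂ p).1))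
    (h : weightRatioPairing π₁ p q = weightRatioPairing π₂ p q) : π₁ p = π₂ p := by
  have hdiff : c * ∑ i, ((π₁ p).1 i - (π₂ p).1 i) ^ 2 / p.1 i = 0 := by
    rw [← sub_eq_zero.2 h, weightRatioPairing, weightRatioPairing, ← Finset.sum_sub_distrib,
      Finset.mul_sum, hq]
    refine Finset.sum_congr rfl fun i _ => ?_
    simp only [PiLp.add_apply, PiLp.sub_apply, PiLp.smul_apply, smul_eq_mul]
    ring
  have hterm := (Finset.sum_eq_zero_iff_of_nonneg
    fun i _ => div_nonneg (sq_nonneg ((π₁ p).1 i - (π₂ p).1 i)) (p.2.1 i).le).1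
      ((mul_eq_zero.1 hdiff).resolve_left hc)
  refine Subtype.ext (PiLp.ext fun i => sub_eq_zero.1 (pow_eq_zero_iff two_ne_zero |>.1 ?_))
  exact (div_eq_zero_iff.1 (hterm i (Finset.mem_univ i))).resolve_right (p.2.1 i).ne'

/-- The market portfolio `π(p) = p`. -/
def marketPortfolio (n : ℕ) (p : openSimplex n) : closedSimplex n :=
  ⟨p.1, fun i => (p.2.1 i).le, p.2.2⟩

theorem logReturn_marketPortfolio (p q : openSimplex n) :
    logReturn (marketPortfolio n) p q = 0 := by
  have hsum : ∑ i, p.1 i * (q.1 i / p.1 i) = 1 :=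
    (Finset.sum_congr rfl fun i _ => mul_div_cancel₀ _ (p.2.1 i).ne').trans q.2.2
  rw [logReturn, one_add_weightRatioPairing, marketPortfolio, hsum, Real.log_one]

/-- The pointwise midpoint of two portfolios. -/
noncomputable def portfolioMidpoint (π₁ π₂ : openSimplex n → closedSimplex n)
    (p : openSimplex n) : closedSimplex n :=
  ⟨midpoint ℝ (π₁ p).1 (π₂ p).1, (convex_closedSimplex n).midpoint_mem (π₁ p).2 (π₂ p).2⟩

theorem measurable_portfolioMidpoint (h₁ : Measurable π₁) (h₂ : Measurable π₂) :
    Measurable (portfolioMidpoint π₁ π₂) := by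
  refine Measurable.subtype_mk ?_
  simp only [midpoint_eq_smul_add]
  fun_prop

/-- The excess of the log return of the midpoint of `π₁` and `π₂` over the average of their log
returns, in the closed form that makes it visibly nonnegative; see
`logReturn_portfolioMidpoint`. -/
noncomputable def logReturnGap (π₁ π₂ : openSimplex n → closedSimplex n) (p q : openSimplex n) :
    ℝ :=
  Real.log (Real.cosh ((logReturn π₁ p q - logReturn π₂ p q) / 2))

theorem logReturnGap_nonneg (p q : openSimplex n) : 0 ≤ logReturnGap π₁ π₂ p q :=
  log_cosh_nonneg _

theorem logReturnGap_eq_zero_iff {p q : openSimplex n} :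
    logReturnGap π₁ π₂ p q = 0 ↔ weightRatioPairing π₁ p q = weightRatioPairing π₂ p q := by
  rw [logReturnGap, log_cosh_eq_zero, div_eq_zero_iff, or_iff_left two_ne_zero, sub_eq_zero,
    logReturn_eq_logReturn_iff]

theorem logReturn_portfolioMidpoint (p q : openSimplex n) :
    logReturn (portfolioMidpoint π₁ π₂) p q =
      (logReturn π₁ p q + logReturn π₂ p q) / 2 + logReturnGap π₁ π₂ p q := by
  have hmid : 1 + weightRatioPairing (portfolioMidpoint π₁ π₂) p q =
      ((1 + weightRatioPairing π₁ p q) + (1 + weightRatioPairing π₂ p q)) / 2 := by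
    simp only [one_add_weightRatioPairing, portfolioMidpoint, midpoint_eq_smul_add,
      PiLp.smul_apply, PiLp.add_apply, smul_eq_mul, ← Finset.sum_add_distrib, Finset.sum_div]
    refine Finset.sum_congr rfl fun i _ => ?_
    rw [invOf_eq_inv]
    ring
  rw [logReturn, hmid, log_add_div_two (one_add_weightRatioPairing_pos π₁ p q)
    (one_add_weightRatioPairing_pos π₂ p q)]
  rfl

end Portfolio

namespace IsFunctionallyGenerated

variable {n : ℕ} {π π₁ π₂ : openSimplex n → closedSimplex n}
  {Φ Φ₁ Φ₂ : EuclideanSpace ℝ (Fin n) → ℝ}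

theorem of_superdiff (hπ : Measurable π) (hpos : ∀ p ∈ openSimplex n, 0 < Φ p)
    (hsup : ∀ p q : openSimplex n, Φ q / Φ p ≤ 1 + weightRatioPairing π p q) :
    IsFunctionallyGenerated π Φ := by
  refine ⟨hπ, ⟨openSimplex.convex, fun x hx y hy a b ha hb hab => ?_⟩, hpos, hsup⟩
  let p : openSimplex n := ⟨a • x + b • y, openSimplex.convex hx hy ha hb hab⟩
  have hbound (q : openSimplex n) : Φ q ≤ (1 + weightRatioPairing π p q) * Φ p :=
    (div_le_iff₀ (hpos p p.2)).1 (hsup p q)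
  have hzero := smul_weightRatioPairing_add_eq_zero π (p := p) (x := ⟨x, hx⟩) (y := ⟨y, hy⟩) hab rfl
  calc a * Φ x + b * Φ y
      ≤ a * ((1 + weightRatioPairing π p ⟨x, hx⟩) * Φ p)
        + b * ((1 + weightRatioPairing π p ⟨y, hy⟩) * Φ p) :=
      add_le_add (mul_le_mul_of_nonneg_left (hbound ⟨x, hx⟩) ha)
        (mul_le_mul_of_nonneg_left (hbound ⟨y, hy⟩) hb)
    _ = Φ p := by linear_combination Φ p * hab + Φ p * hzero

theorem of_log_sub_log_le_logReturn (hπ : Measurable π) (hpos : ∀ p ∈ openSimplex n, 0 < Φ p)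
    (h : ∀ p q : openSimplex n, Real.log (Φ q) - Real.log (Φ p) ≤ logReturn π p q) :
    IsFunctionallyGenerated π Φ := by
  refine of_superdiff hπ hpos fun p q => ?_
  have hp := hpos p p.2
  have hq := hpos q q.2
  rw [← Real.log_le_log_iff (div_pos hq hp) (one_add_weightRatioPairing_pos π p q),
    Real.log_div hq.ne' hp.ne']
  exact h p q

theorem lDivergence_eq (h : IsFunctionallyGenerated π Φ) (p q : openSimplex n) :
    LDivergence π Φ q p = logReturn π p q - (Real.log (Φ q) - Real.log (Φ p)) := by
  rw [LDivergence, Real.log_div (h.pos q q.2).ne' (h.pos p p.2).ne', logReturn]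

theorem lDivergence_nonneg (h : IsFunctionallyGenerated π Φ) (p q : openSimplex n) :
    0 ≤ LDivergence π Φ q p :=
  sub_nonneg.2 (Real.log_le_log (div_pos (h.pos q q.2) (h.pos p p.2)) (h.superdiff p q))

theorem log_sub_log_le_logReturn (h : IsFunctionallyGenerated π Φ) (p q : openSimplex n) :
    Real.log (Φ q) - Real.log (Φ p) ≤ logReturn π p q :=
  sub_nonneg.1 ((h.lDivergence_nonneg p q).trans_eq (h.lDivergence_eq p q))

theorem dist_log_le (h : IsFunctionallyGenerated π Φ) (p q : openSimplex n) :
    dist (Real.log (Φ p)) (Real.log (Φ q)) ≤ logDist p q := by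
  have hle (p q : openSimplex n) : Real.log (Φ q) - Real.log (Φ p) ≤ logDist p q :=
    (h.log_sub_log_le_logReturn p q).trans ((le_abs_self _).trans (abs_logReturn_le π p q))
  exact abs_sub_le_iff.2 ⟨(hle q p).trans_eq (logDist_comm q p), hle p q⟩

theorem continuous_log (h : IsFunctionallyGenerated π Φ) :
    Continuous fun p : openSimplex n => Real.log (Φ p) := by
  refine continuous_iff_continuousAt.2 fun p => tendsto_iff_dist_tendsto_zero.2 ?_
  have hlim : Tendsto (fun q => logDist q p) (𝓝 p) (𝓝 0) :=
    logDist_self p ▸ (continuous_logDist.comp (.prodMk_left p)).tendsto p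
  exact squeeze_zero (fun _ => dist_nonneg) (fun q => h.dist_log_le q p) hlim

theorem measurable_lDivergence (h : IsFunctionallyGenerated π Φ) :
    Measurable fun x : openSimplex n × openSimplex n => LDivergence π Φ x.2 x.1 := by
  simp only [h.lDivergence_eq]
  have hlog := h.continuous_log.measurable
  exact (measurable_logReturn h.measurable).sub
    ((hlog.comp measurable_snd).sub (hlog.comp measurable_fst))

theorem norm_lDivergence_le (h : IsFunctionallyGenerated π Φ) (p q : openSimplex n) :
    ‖LDivergence π Φ q p‖ ≤ 2 * logDist p q := by
  have hΦ := abs_le.1 (h.dist_log_le p q)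
  rw [Real.norm_of_nonneg (h.lDivergence_nonneg p q), h.lDivergence_eq]
  linarith [(abs_le.1 (abs_logReturn_le π p q)).2]

theorem marketPortfolio (n : ℕ) : IsFunctionallyGenerated (marketPortfolio n) fun _ => 1 :=
  of_log_sub_log_le_logReturn measurable_subtype_coe.subtype_mk (fun _ _ => one_pos) fun p q => by
    rw [logReturn_marketPortfolio, sub_self]

theorem log_sqrt_mul (h₁ : IsFunctionallyGenerated π₁ Φ₁) (h₂ : IsFunctionallyGenerated π₂ Φ₂)
    (p : openSimplex n) :
    Real.log √(Φ₁ p * Φ₂ p) = (Real.log (Φ₁ p) + Real.log (Φ₂ p)) / 2 := by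
  have hΦ₁ := h₁.pos p p.2
  have hΦ₂ := h₂.pos p p.2
  rw [Real.log_sqrt (mul_pos hΦ₁ hΦ₂).le, Real.log_mul hΦ₁.ne' hΦ₂.ne']

theorem midpoint (h₁ : IsFunctionallyGenerated π₁ Φ₁) (h₂ : IsFunctionallyGenerated π₂ Φ₂) :
    IsFunctionallyGenerated (portfolioMidpoint π₁ π₂) fun p => √(Φ₁ p * Φ₂ p) := by
  refine of_log_sub_log_le_logReturn (measurable_portfolioMidpoint h₁.measurable h₂.measurable)
    (fun p hp => Real.sqrt_pos.2 (mul_pos (h₁.pos p hp) (h₂.pos p hp))) fun p q => ?_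
  rw [log_sqrt_mul h₁ h₂, log_sqrt_mul h₁ h₂, logReturn_portfolioMidpoint]
  linarith [h₁.log_sub_log_le_logReturn p q, h₂.log_sub_log_le_logReturn p q,
    logReturnGap_nonneg (π₁ := π₁) (π₂ := π₂) p q]

theorem lDivergence_midpoint (h₁ : IsFunctionallyGenerated π₁ Φ₁)
    (h₂ : IsFunctionallyGenerated π₂ Φ₂) (p q : openSimplex n) :
    LDivergence (portfolioMidpoint π₁ π₂) (fun p => √(Φ₁ p * Φ₂ p)) q p =
      (LDivergence π₁ Φ₁ q p + LDivergence π₂ Φ₂ q p) / 2 + logReturnGap π₁ π₂ p q := by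
  rw [(h₁.midpoint h₂).lDivergence_eq, h₁.lDivergence_eq, h₂.lDivergence_eq, log_sqrt_mul h₁ h₂,
    log_sqrt_mul h₁ h₂, logReturn_portfolioMidpoint]
  ring

theorem of_tendsto {ι : Type*} {σ : ι → openSimplex n → closedSimplex n}
    {Ψ : ι → EuclideanSpace ℝ (Fin n) → ℝ} (h : ∀ k, IsFunctionallyGenerated (σ k) (Ψ k))
    (hπ : Measurable π) (hpos : ∀ p ∈ openSimplex n, 0 < Φ p)
    {l : openSimplex n → Filter ι} [∀ p, (l p).NeBot]
    (hσ : ∀ p, Tendsto (fun k => σ k p) (l p) (𝓝 (π p)))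
    (hΨ : ∀ p q : openSimplex n, Tendsto (fun k => Real.log (Ψ k q) - Real.log (Ψ k p)) (l p)
      (𝓝 (Real.log (Φ q) - Real.log (Φ p)))) :
    IsFunctionallyGenerated π Φ :=
  of_log_sub_log_le_logReturn hπ hpos fun p q =>
    le_of_tendsto_of_tendsto' (hΨ p q) (tendsto_logReturn (hσ p) q) fun k =>
      (h k).log_sub_log_le_logReturn p q

end IsFunctionallyGenerated

section Objective

variable {n : ℕ} {P : Measure (openSimplex n × openSimplex n)}
  {π π₁ π₂ : openSimplex n → closedSimplex n} {Φ Φ₁ Φ₂ : EuclideanSpace ℝ (Fin n) → ℝ}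

theorem IsFunctionallyGenerated.integrable_lDivergence (h : IsFunctionallyGenerated π Φ)
    (hP : Integrable (fun x => logDist x.1 x.2) P) :
    Integrable (fun x => LDivergence π Φ x.2 x.1) P :=
  (hP.const_mul 2).mono' h.measurable_lDivergence.aestronglyMeasurable
    (.of_forall fun x => h.norm_lDivergence_le x.1 x.2)

/-- The objective `∫ T(q ∣ p) dP(p, q)` of the optimization problem. -/
noncomputable def expectedLDivergence (P : Measure (openSimplex n × openSimplex n))
    (π : openSimplex n → closedSimplex n) (Φ : EuclideanSpace ℝ (Fin n) → ℝ) : ℝ :=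
  ∫ x, LDivergence π Φ x.2 x.1 ∂P

/-- The supremum of the objective over all functionally generated portfolios. -/
noncomputable def optimalValue (P : Measure (openSimplex n × openSimplex n)) : ℝ :=
  sSup {J | ∃ π Φ, IsFunctionallyGenerated π Φ ∧ expectedLDivergence P π Φ = J}

theorem expectedLDivergence_le_optimalValue (hP : Integrable (fun x => logDist x.1 x.2) P)
    (h : IsFunctionallyGenerated π Φ) : expectedLDivergence P π Φ ≤ optimalValue P := by
  refine le_csSup ⟨∫ x, 2 * logDist x.1 x.2 ∂P, ?_⟩ ⟨π, Φ, h, rfl⟩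
  rintro _ ⟨π', Φ', h', rfl⟩
  exact integral_mono (h'.integrable_lDivergence hP) (hP.const_mul 2) fun x =>
    (le_abs_self _).trans (h'.norm_lDivergence_le x.1 x.2)

theorem exists_lt_expectedLDivergence {v : ℝ} (hv : v < optimalValue P) :
    ∃ π Φ, IsFunctionallyGenerated π Φ ∧ v < expectedLDivergence P π Φ := by
  obtain ⟨_, ⟨π, Φ, h, rfl⟩, hlt⟩ :=
    exists_lt_of_lt_csSup (by exact ⟨_, _, _, .marketPortfolio n, rfl⟩) hv
  exact ⟨π, Φ, h, hlt⟩

theorem IsFunctionallyGenerated.isOptimalPortfolio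
    (hP : Integrable (fun x => logDist x.1 x.2) P) (h : IsFunctionallyGenerated π Φ)
    (hopt : optimalValue P ≤ expectedLDivergence P π Φ) : IsOptimalPortfolio P π Φ :=
  ⟨h, fun _ _ h' => (expectedLDivergence_le_optimalValue hP h').trans hopt⟩

theorem integrable_logReturnGap (hP : Integrable (fun x => logDist x.1 x.2) P)
    (h₁ : IsFunctionallyGenerated π₁ Φ₁) (h₂ : IsFunctionallyGenerated π₂ Φ₂) :
    Integrable (fun x => logReturnGap π₁ π₂ x.1 x.2) P := by
  refine (((h₁.midpoint h₂).integrable_lDivergence hP).sub (((h₁.integrable_lDivergence hP).add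
    (h₂.integrable_lDivergence hP)).div_const 2)).congr (.of_forall fun x => ?_)
  exact sub_eq_of_eq_add' (h₁.lDivergence_midpoint h₂ x.1 x.2)

theorem expectedLDivergence_midpoint (hP : Integrable (fun x => logDist x.1 x.2) P)
    (h₁ : IsFunctionallyGenerated π₁ Φ₁) (h₂ : IsFunctionallyGenerated π₂ Φ₂) :
    expectedLDivergence P (portfolioMidpoint π₁ π₂) (fun p => √(Φ₁ p * Φ₂ p)) =
      (expectedLDivergence P π₁ Φ₁ + expectedLDivergence P π₂ Φ₂) / 2
        + ∫ x, logReturnGap π₁ π₂ x.1 x.2 ∂P := by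
  have i₁ := h₁.integrable_lDivergence hP
  have i₂ := h₂.integrable_lDivergence hP
  have iavg : Integrable (fun x => (LDivergence π₁ Φ₁ x.2 x.1 + LDivergence π₂ Φ₂ x.2 x.1) / 2) P :=
    (i₁.add i₂).div_const 2
  simp only [expectedLDivergence, h₁.lDivergence_midpoint h₂]
  rw [integral_add iavg (integrable_logReturnGap hP h₁ h₂), integral_div, integral_add i₁ i₂]

theorem integral_logReturnGap_le (hP : Integrable (fun x => logDist x.1 x.2) P)
    (h₁ : IsFunctionallyGenerated π₁ Φ₁) (h₂ : IsFunctionallyGenerated π₂ Φ₂) :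
    ∫ x, logReturnGap π₁ π₂ x.1 x.2 ∂P ≤
      optimalValue P - (expectedLDivergence P π₁ Φ₁ + expectedLDivergence P π₂ Φ₂) / 2 := by
  linarith [expectedLDivergence_midpoint hP h₁ h₂,
    expectedLDivergence_le_optimalValue hP (h₁.midpoint h₂)]

end Objective

section Uniqueness

variable {n : ℕ} {P : Measure (openSimplex n × openSimplex n)}
  {π₁ π₂ : openSimplex n → closedSimplex n} {Φ₁ Φ₂ : EuclideanSpace ℝ (Fin n) → ℝ}

theorem IsOptimalPortfolio.expectedLDivergence_eq (h : IsOptimalPortfolio P π₁ Φ₁)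
    (hP : Integrable (fun x => logDist x.1 x.2) P) :
    expectedLDivergence P π₁ Φ₁ = optimalValue P := by
  refine le_antisymm (expectedLDivergence_le_optimalValue hP h.1) (le_of_forall_lt fun v hv => ?_)
  obtain ⟨π', Φ', h', hlt⟩ := exists_lt_expectedLDivergence hv
  exact hlt.trans_le (h.2 π' Φ' h')

theorem IsOptimalPortfolio.ae_weightRatioPairing_eq (h₁ : IsOptimalPortfolio P π₁ Φ₁)
    (h₂ : IsOptimalPortfolio P π₂ Φ₂) (hP : Integrable (fun x => logDist x.1 x.2) P) :
    ∀ᵐ x ∂P, weightRatioPairing π₁ x.1 x.2 = weightRatioPairing π₂ x.1 x.2 := by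
  have hle : ∫ x, logReturnGap π₁ π₂ x.1 x.2 ∂P ≤ 0 := by
    linarith [integral_logReturnGap_le hP h₁.1 h₂.1, h₁.expectedLDivergence_eq hP,
      h₂.expectedLDivergence_eq hP]
  have hnonneg : ∀ x : openSimplex n × openSimplex n, 0 ≤ logReturnGap π₁ π₂ x.1 x.2 :=
    fun x => logReturnGap_nonneg x.1 x.2
  have hzero := (integral_eq_zero_iff_of_nonneg hnonneg (integrable_logReturnGap hP h₁.1 h₂.1)).1
    (hle.antisymm (integral_nonneg hnonneg))
  filter_upwards [hzero] with x hx using logReturnGap_eq_zero_iff.1 hx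

theorem ae_portfolio_eq_of_supportCondition
    (h : ∀ᵐ x ∂P, weightRatioPairing π₁ x.1 x.2 = weightRatioPairing π₂ x.1 x.2)
    {f : openSimplex n → ℝ≥0∞} (hf : Measurable f)
    {κ : Kernel (openSimplex n) (openSimplex n)} [IsSFiniteKernel κ]
    (hfst : P.fst = (simplexMeasure n).withDensity f) (hκ : P = P.fst.compProd κ)
    (hs : SupportCondition f κ) : ∀ᵐ p ∂simplexMeasure n, 0 < f p → π₁ p = π₂ p := by
  have : SFinite P := by
    rw [hκ]
    infer_instance
  have hsections : ∀ᵐ p ∂simplexMeasure n, f p ≠ 0 →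
      ∀ᵐ q ∂κ p, weightRatioPairing π₁ p q = weightRatioPairing π₂ p q := by
    rw [← ae_withDensity_iff hf, ← hfst]
    exact Measure.ae_ae_of_ae_compProd (hκ ▸ h)
  filter_upwards [hsections, hs] with p hp hsp hfp
  have hsub := Measure.support_subset_of_isClosed
    (isClosed_eq (continuous_weightRatioPairing π₁ p) (continuous_weightRatioPairing π₂ p))
    (hp hfp.ne')
  obtain ⟨c, hc, q, hq, hqv⟩ := hsp hfp ((π₁ p).1 - (π₂ p).1) (by
    simp only [PiLp.sub_apply, Finset.sum_sub_distrib, (π₁ p).2.2, (π₂ p).2.2, sub_self])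
  exact portfolio_eq_of_weightRatioPairing_eq hc.ne' hqv (hsub hq)

end Uniqueness

section Existence

variable {n : ℕ} {P : Measure (openSimplex n × openSimplex n)}
  {σ : ℕ → openSimplex n → closedSimplex n} {Φ : ℕ → EuclideanSpace ℝ (Fin n) → ℝ}

theorem exists_subseq_tendsto_log_sub_log (h : ∀ k, IsFunctionallyGenerated (σ k) (Φ k)) :
    ∃ φ : ℕ → ℕ, StrictMono φ ∧ ∃ Ψ : EuclideanSpace ℝ (Fin n) → ℝ,
      (∀ p ∈ openSimplex n, 0 < Ψ p) ∧ ∀ p q : openSimplex n,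
        Tendsto (fun k => Real.log (Φ (φ k) q) - Real.log (Φ (φ k) p)) atTop
          (𝓝 (Real.log (Ψ q) - Real.log (Ψ p))) := by
  rcases isEmpty_or_nonempty (openSimplex n) with hempty | ⟨⟨c⟩⟩
  · exact ⟨id, strictMono_id, 1, fun p hp => hempty.elim ⟨p, hp⟩, fun p => hempty.elim p⟩
  let F : ℕ → openSimplex n → ℝ := fun k p => Real.log (Φ k p) - Real.log (Φ k c)
  have hdist (k : ℕ) (p q : openSimplex n) : dist (F k p) (F k q) ≤ logDist p q :=
    (dist_sub_right _ _ _).trans_le ((h k).dist_log_le p q)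
  have hequi : Equicontinuous F := fun p => Metric.equicontinuousAt_of_continuity_modulus
    (logDist p) (logDist_self p ▸ (continuous_logDist.comp (.prodMk_right p)).tendsto p) F
    (.of_forall fun q k => hdist k p q)
  have hcompact (p : openSimplex n) : ∃ Q, IsCompact Q ∧ ∀ k, F k p ∈ Q :=
    ⟨_, isCompact_closedBall 0 (logDist p c), fun k => by simpa [F] using hdist k p c⟩
  obtain ⟨φ, hφ, l, hl⟩ := exists_subseq_tendsto_of_equicontinuous hequi hcompact
  refine ⟨φ, hφ, Function.extend Subtype.val (fun p => Real.exp (l p)) 1, fun p hp => ?_,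
    fun p q => ?_⟩
  · rw [Subtype.val_injective.extend_apply _ _ ⟨p, hp⟩]
    exact Real.exp_pos _
  · simp only [Subtype.val_injective.extend_apply, Real.log_exp]
    simpa only [F, sub_sub_sub_cancel_right] using (hl q).sub (hl p)

theorem exists_measurable_limit_portfolio (hσ : ∀ k, Measurable (σ k)) :
    ∃ (ρ : openSimplex n → closedSimplex n) (N : ℕ → openSimplex n → ℕ), Measurable ρ ∧
      (∀ p, Tendsto (fun j => N j p) atTop atTop) ∧
      ∀ p, Tendsto (fun j => σ (N j p) p) atTop (𝓝 (ρ p)) := by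
  obtain ⟨N, hNm, hN, hlim⟩ := exists_measurable_index_tendsto_pi
    (f := fun k p => (σ k p).1.ofLp) (fun k => by fun_prop) fun p i => ⟨1, fun k => by
      rw [abs_of_nonneg ((σ k p).2.1 i), ← (σ k p).2.2]
      exact Finset.single_le_sum (fun j _ => (σ k p).2.1 j) (Finset.mem_univ i)⟩
  choose l hl using hlim
  have hval (p : openSimplex n) :
      Tendsto (fun j => (σ (N j p) p).1) atTop (𝓝 (WithLp.toLp 2 (l p))) :=
    ((PiLp.continuous_toLp 2 _).tendsto (l p)).comp (hl p)
  let ρ : openSimplex n → closedSimplex n := fun p => ⟨WithLp.toLp 2 (l p),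
    (isClosed_closedSimplex n).mem_of_tendsto (hval p) (.of_forall fun j => (σ (N j p) p).2)⟩
  have hρ (p : openSimplex n) : Tendsto (fun j => σ (N j p) p) atTop (𝓝 (ρ p)) :=
    tendsto_subtype_rng.2 (hval p)
  exact ⟨ρ, N, measurable_of_tendsto_metrizable
    (fun j => measurable_apply_of_countable hσ (hNm j)) (tendsto_pi_nhds.2 hρ), hN, hρ⟩

theorem ae_exists_tendsto_logReturn (hP : Integrable (fun x => logDist x.1 x.2) P)
    (h : ∀ k, IsFunctionallyGenerated (σ k) (Φ k))
    (hσ : ∀ k, optimalValue P - (1 / 8) ^ k ≤ expectedLDivergence P (σ k) (Φ k)) :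
    ∀ᵐ x ∂P, ∃ l, Tendsto (fun k => logReturn (σ k) x.1 x.2) atTop (𝓝 l) := by
  have hint (k : ℕ) := (integrable_logReturnGap hP (h k) (h (k + 1))).const_mul (4 ^ k)
  have hgap (k : ℕ) : ∫ x, logReturnGap (σ k) (σ (k + 1)) x.1 x.2 ∂P ≤ (1 / 8) ^ k := by
    have hpow : (1 / 8 : ℝ) ^ (k + 1) ≤ (1 / 8) ^ k :=
      pow_le_pow_of_le_one (by norm_num) (by norm_num) k.le_succ
    linarith [integral_logReturnGap_le hP (h k) (h (k + 1)), hσ k, hσ (k + 1)]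
  have hsum : Summable fun k : ℕ => ∫ x, ‖4 ^ k * logReturnGap (σ k) (σ (k + 1)) x.1 x.2‖ ∂P := by
    refine .of_nonneg_of_le (fun k => by positivity) (fun k => ?_) summable_geometric_two
    simp only [norm_mul, norm_pow, Real.norm_ofNat, Real.norm_of_nonneg (logReturnGap_nonneg _ _),
      integral_const_mul]
    calc 4 ^ k * ∫ x, logReturnGap (σ k) (σ (k + 1)) x.1 x.2 ∂P ≤ 4 ^ k * (1 / 8) ^ k := by
          gcongr
          exact hgap k
      _ = (1 / 2) ^ k := by rw [← mul_pow]; norm_num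
  filter_upwards [ae_summable_norm_of_summable_integral_norm hint hsum] with x hx
  exact exists_tendsto_of_tendsto_mul_log_cosh hx.of_norm.tendsto_atTop_zero

theorem tendsto_expectedLDivergence (hP : Integrable (fun x => logDist x.1 x.2) P)
    (h : ∀ k, IsFunctionallyGenerated (σ k) (Φ k))
    {ρ : openSimplex n → closedSimplex n} {Ψ : EuclideanSpace ℝ (Fin n) → ℝ}
    (hρ : IsFunctionallyGenerated ρ Ψ)
    (hret : ∀ᵐ x ∂P, Tendsto (fun k => logReturn (σ k) x.1 x.2) atTop
      (𝓝 (logReturn ρ x.1 x.2)))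
    (hΨ : ∀ p q : openSimplex n, Tendsto (fun k => Real.log (Φ k q) - Real.log (Φ k p)) atTop
      (𝓝 (Real.log (Ψ q) - Real.log (Ψ p)))) :
    Tendsto (fun k => expectedLDivergence P (σ k) (Φ k)) atTop (𝓝 (expectedLDivergence P ρ Ψ)) := by
  refine tendsto_integral_of_dominated_convergence (fun x => 2 * logDist x.1 x.2)
    (fun k => (h k).measurable_lDivergence.aestronglyMeasurable) (hP.const_mul 2)
    (fun k => .of_forall fun x => (h k).norm_lDivergence_le x.1 x.2) ?_
  filter_upwards [hret] with x hx
  simp only [hρ.lDivergence_eq, (h _).lDivergence_eq]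
  exact hx.sub (hΨ x.1 x.2)

theorem exists_isOptimalPortfolio (hP : Integrable (fun x => logDist x.1 x.2) P) :
    ∃ π Φ, IsOptimalPortfolio P π Φ := by
  have hmax (k : ℕ) : optimalValue P - (1 / 8) ^ k < optimalValue P :=
    sub_lt_self _ (by positivity)
  choose σ Φ hFG hval using fun k => exists_lt_expectedLDivergence (hmax k)
  obtain ⟨φ, hφ, Ψ, hΨpos, hΨ⟩ := exists_subseq_tendsto_log_sub_log hFG
  obtain ⟨ρ, N, hρm, hN, hρ⟩ :=
    exists_measurable_limit_portfolio fun k => (hFG (φ k)).measurable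
  have hopt : IsFunctionallyGenerated ρ Ψ := .of_tendsto (l := fun p => map (fun j => N j p) atTop)
    (fun k => hFG (φ k)) hρm hΨpos hρ fun p q => (hΨ p q).mono_left (hN p)
  have hret : ∀ᵐ x ∂P,
      Tendsto (fun k => logReturn (σ (φ k)) x.1 x.2) atTop (𝓝 (logReturn ρ x.1 x.2)) := by
    filter_upwards [ae_exists_tendsto_logReturn hP hFG fun k => (hval k).le] with x ⟨l, hl⟩
    have hsub := hl.comp hφ.tendsto_atTop
    exact tendsto_nhds_unique (tendsto_logReturn (hρ x.1) x.2) (hsub.comp (hN x.1)) ▸ hsub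
  have hlim := tendsto_expectedLDivergence hP (fun k => hFG (φ k)) hopt hret hΨ
  have hbound : Tendsto (fun k => optimalValue P - (1 / 8) ^ φ k) atTop (𝓝 (optimalValue P)) := by
    simpa using ((tendsto_pow_atTop_nhds_zero_of_lt_one (by norm_num : (0 : ℝ) ≤ 1 / 8)
      (by norm_num)).comp hφ.tendsto_atTop).const_sub (optimalValue P)
  exact ⟨ρ, Ψ, hopt.isOptimalPortfolio hP
    (le_of_tendsto_of_tendsto' hbound hlim fun k => (hval (φ k)).le)⟩

end Existence

theorem theorem5p4_general {n : ℕ} (P : Measure (openSimplex n × openSimplex n))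
    (hP : Integrable (fun x => logDist x.1 x.2) P) :
    (∀ (π : openSimplex n → closedSimplex n) (Φ : EuclideanSpace ℝ (Fin n) → ℝ),
      IsFunctionallyGenerated π Φ → Integrable (fun x => LDivergence π Φ x.2 x.1) P) ∧
    (∃ (π : openSimplex n → closedSimplex n) (Φ : EuclideanSpace ℝ (Fin n) → ℝ),
      IsOptimalPortfolio P π Φ) ∧
    (∀ (π₁ π₂ : openSimplex n → closedSimplex n) (Φ₁ Φ₂ : EuclideanSpace ℝ (Fin n) → ℝ),
      IsOptimalPortfolio P π₁ Φ₁ → IsOptimalPortfolio P π₂ Φ₂ →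
        (∀ᵐ x ∂P, weightRatioPairing π₁ x.1 x.2 = weightRatioPairing π₂ x.1 x.2) ∧
        ∀ (f : openSimplex n → ℝ≥0∞) (κ : Kernel (openSimplex n) (openSimplex n)),
          Measurable f → IsSFiniteKernel κ → P.fst = (simplexMeasure n).withDensity f →
          P = P.fst.compProd κ → SupportCondition f κ →
            ∀ᵐ p ∂simplexMeasure n, 0 < f p → π₁ p = π₂ p) := by
  refine ⟨fun π Φ h => h.integrable_lDivergence hP, exists_isOptimalPortfolio hP,
    fun π₁ π₂ Φ₁ Φ₂ h₁ h₂ => ?_⟩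
  have hae := h₁.ae_weightRatioPairing_eq h₂ hP
  exact ⟨hae, fun f κ hf _ hfst hκ hs => ae_portfolio_eq_of_supportCondition hae hf hfst hκ hs⟩

theorem theorem5p4 {n : ℕ} (hn : 2 ≤ n)
    (P : Measure (openSimplex n × openSimplex n)) [IsProbabilityMeasure P]
    (hP : IsDiscreteMeasure P ∨ P ≪ (simplexMeasure n).prod (simplexMeasure n))
    (K : Set (openSimplex n)) (hK : IsCompact K) (hPK : P (K ×ˢ K)ᶜ = 0) :
    -- the objective is a finite integral for every functionally generated portfolio
    (∀ (π : openSimplex n → closedSimplex n) (Φ : EuclideanSpace ℝ (Fin n) → ℝ),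
      IsFunctionallyGenerated π Φ →
        Integrable (fun x => LDivergence π Φ x.2 x.1) P) ∧
    -- (i) existence of an optimal solution
    (∃ (π : openSimplex n → closedSimplex n) (Φ : EuclideanSpace ℝ (Fin n) → ℝ),
      IsOptimalPortfolio P π Φ) ∧
    -- (ii) uniqueness
    (∀ (π₁ π₂ : openSimplex n → closedSimplex n) (Φ₁ Φ₂ : EuclideanSpace ℝ (Fin n) → ℝ),
      IsOptimalPortfolio P π₁ Φ₁ → IsOptimalPortfolio P π₂ Φ₂ →
        (∀ᵐ x ∂P, weightRatioPairing π₁ x.1 x.2 = weightRatioPairing π₂ x.1 x.2) ∧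
        (P ≪ (simplexMeasure n).prod (simplexMeasure n) →
          ∀ (f : openSimplex n → ℝ≥0∞) (κ : Kernel (openSimplex n) (openSimplex n)),
            Measurable f → IsMarkovKernel κ →
            P.fst = (simplexMeasure n).withDensity f →
            P = P.fst.compProd κ →
            SupportCondition f κ →
              ∀ᵐ p ∂(simplexMeasure n), 0 < f p → π₁ p = π₂ p)) := by
  obtain ⟨hint, hexists, hunique⟩ :=
    theorem5p4_general P (integrable_logDist_of_isCompact hK hPK)
  exact ⟨hint, hexists, fun π₁ π₂ Φ₁ Φ₂ h₁ h₂ => (hunique π₁ π₂ Φ₁ Φ₂ h₁ h₂).imp_right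
    fun h _ f κ hf _ => h f κ hf inferInstance⟩
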